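/- Let $\mathbb{T}^3=\mathbb{R}^3/(2\pi\mathbb{Z})^3$ be the flat torus. Call a probability measure $\mu$ on $\mathbb{T}^3$ a quantum limit if it is the weak limit of measures $|u_j|^2\,dx$, where $u_j\in C^\infty(\mathbb{T}^3)$ is complex-valued, $-\Delta u_j=\lambda_j^2u_j$, $\int_{\mathbb{T}^3}|u_j|^2\,dx=1$ and $\lambda_j\to\infty$; let $\mathcal{Q}$ be the set of all quantum limits. For $r\in(0,1)$ let $B_r\subset\mathbb{T}^3$ be the (image of the) Euclidean ball of radius $r$ centered at $0$, and put $$m_3(r)=\inf_{\mu\in\mathcal{Q}}\frac{\mu(B_r)}{|B_r|}.$$ **Theorem.** There is a universal constant $C>0$ such that for every $r_0\in(0,1/e)$ there is a constant $A>0$, depending only on $r_0$, such that $$m_3(r)\le A\exp\Bigl\{-\exp\Bigl(\frac{C\ln(1/r)}{\ln\ln(1/r)}\Bigr)\Bigr\}\qquad\text{for all } r\in(0,r_0]\cup(1/e,1).$$ -/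

import Mathlib

open MeasureTheory Filter Topology
open scoped ENNReal ContDiff Laplacian

namespace TorusQL

instance factTwoPiPos : Fact (0 < 2 * Real.pi) := ⟨Real.two_pi_pos⟩

/-- The flat torus `ℝ^d / (2πℤ)^d`.  Its `volume` is the product measure of total mass `(2π)^d`. -/
abbrev Torus (d : ℕ) : Type := Fin d → AddCircle (2 * Real.pi)

/-- The quotient map `ℝ^d → ℝ^d / (2πℤ)^d`. -/
noncomputable def toTorus (d : ℕ) (x : EuclideanSpace ℝ (Fin d)) : Torus d :=
  fun i => (x i : AddCircle (2 * Real.pi))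

/-- `u` belongs to the eigenspace `{u ∈ C^∞(𝕋^d) : -Δu = lam² u}`.  Smooth functions on the torus
are the functions whose periodic lift to `ℝ^d` is smooth, and `Δ` is computed on that lift. -/
def IsEigenfunction (d : ℕ) (lam : ℝ) (u : Torus d → ℂ) : Prop :=
  ContDiff ℝ ∞ (u ∘ toTorus d) ∧
    ∀ x : EuclideanSpace ℝ (Fin d),
      -(Δ (u ∘ toTorus d)) x = ((lam ^ 2 : ℝ) : ℂ) * u (toTorus d x)

/-- The measure `|u|² dx` on the torus. -/
noncomputable def densityMeasure (d : ℕ) (u : Torus d → ℂ) : Measure (Torus d) :=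
  (volume : Measure (Torus d)).withDensity (fun x => ‖u x‖ₑ ^ 2)

/-- The set of quantum limits: weak limits of `|u_j|² dx`, where `u_j` is an eigenfunction of
`L²`-norm one associated with the eigenvalue `lam_j²`, and `lam_j → ∞`.
Convergence in `ProbabilityMeasure` is weak convergence of measures. -/
def quantumLimits (d : ℕ) : Set (ProbabilityMeasure (Torus d)) :=
  {μ | ∃ (lam : ℕ → ℝ) (u : ℕ → Torus d → ℂ) (ν : ℕ → ProbabilityMeasure (Torus d)),
    (∀ j, IsEigenfunction d (lam j) (u j)) ∧
    (∀ j, ∫ x, ‖u j x‖ ^ 2 = 1) ∧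
    (∀ j, (ν j : Measure (Torus d)) = densityMeasure d (u j)) ∧
    Tendsto lam atTop atTop ∧
    Tendsto ν atTop (𝓝 μ)}

/-- The Euclidean ball `B_r = {|x| < r}` viewed in the torus. -/
def torusBall (d : ℕ) (r : ℝ) : Set (Torus d) :=
  toTorus d '' Metric.ball (0 : EuclideanSpace ℝ (Fin d)) r

/-- `m_d(r) = inf_μ μ(B_r) / |B_r|`, the infimum being over all quantum limits `μ`.
It is taken in `[0, ∞]`, where every infimum has its true value. -/
noncomputable def minMass (d : ℕ) (r : ℝ) : ℝ≥0∞ :=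
  ⨅ μ ∈ quantumLimits d,
    (μ : Measure (Torus d)) (torusBall d r) / (volume : Measure (Torus d)) (torusBall d r)

end TorusQL

/-!
For an eigenfunction `v` of the two-dimensional torus, the functions
`u_j(x) = v(x₁, x₂) exp(i j x₃)` are eigenfunctions on `𝕋³` whose eigenvalues tend to infinity and
whose densities `|u_j|²` do not depend on `j`. So every normalized density `|v(x₁, x₂)|²` is a
quantum limit (`minMass_le_of_norm_eq`), and it suffices to find a `v` that is tiny near `0`.

Let the circle `|ξ|² = E` carry `N` lattice points. A combination `v = ∑ a_ξ exp(i ξ · x)` vanishes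
to order `K` at `0` as soon as `∑ a_ξ (ξ · x)^m = 0` for `m < K`. Identifying the plane with `ℂ`,
on the circle `(ξ · x)^m` is a Laurent polynomial in `ξ` with exponents between `-m` and `m`; so
these are `2K - 1` linear conditions on `a`, solvable non-trivially with `K = N / 2`
(`exists_ne_zero_sum_mul_pow_eq_zero`). If `√E r ≤ e⁻²`, Taylor's formula then gives
`|v|² ≤ 4 N e^{-2N} ≤ 4 e^{-N}` on the ball of radius `r` (`minMass_three_le`).

It remains to find circles with many lattice points. A product of `k` distinct odd primes, each a
sum of two squares, is the norm of at least `2^k` Gaussian integers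
(`exists_gaussianInt_norm_eq_prod`). That `k` such primes exist below a constant times `k⁴` follows
from a Chebyshev argument: `∏_{m ≤ M} (4m² + 1)` is at least `4^M (M!)²`, has only prime factors of
the required kind, and each prime `p` divides it at most `2 log_p (4M² + 1)` times more often than
it divides `(M!)²`, because `4m² ≡ -1` has at most two solutions modulo `p^a`
(`two_pow_le_pow_card_primeFactors`). Hence there is `E ≤ (2¹¹ k⁴)^k` with `N ≥ 2^k`, and
`k ≈ log (1/r) / (20 log log (1/r))` keeps `√E r ≤ e⁻²` for small `r`. For the other `r`, the
uniform measure is a quantum limit and gives the bound `minMass ≤ 1`.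
-/

namespace TorusQL

/-! ### Primes that are sums of two squares -/

open Finset in
lemma card_le_div_add_one_of_pairwise_dvd_sub {s : Finset ℕ} {M q : ℕ} (hs : ∀ m ∈ s, m ≤ M)
    (hq : ∀ m ∈ s, ∀ n ∈ s, (q : ℤ) ∣ (m : ℤ) - n) : #s ≤ M / q + 1 := by
  rw [← card_range (M / q + 1)]
  refine card_le_card_of_injOn (fun m => m / q) (fun m hm => ?_) (fun m hm n hn hmn => ?_)
  · simpa [Nat.lt_succ_iff] using Nat.div_le_div_right (hs m hm)
  · have h : n % q = m % q := (Nat.modEq_iff_dvd.2 (hq m hm n hn))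
    rw [← Nat.div_add_mod m q, ← Nat.div_add_mod n q, h]
    simp only at hmn
    rw [hmn]

/-- Modulo a power of an odd prime, `-1` has at most two square roots, which differ by a sign. -/
lemma pow_dvd_sub_or_pow_dvd_add {p a : ℕ} (hp : p.Prime) (h2 : p ≠ 2) {m n : ℤ}
    (hm : ((p ^ a : ℕ) : ℤ) ∣ 4 * m ^ 2 + 1) (hn : ((p ^ a : ℕ) : ℤ) ∣ 4 * n ^ 2 + 1) :
    ((p ^ a : ℕ) : ℤ) ∣ m - n ∨ ((p ^ a : ℕ) : ℤ) ∣ m + n := by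
  have hpZ : Prime (p : ℤ) := Nat.prime_iff_prime_int.1 hp
  rcases Nat.eq_zero_or_pos a with rfl | ha
  · simp
  have hp2 : ¬ (p : ℤ) ∣ 2 := by
    intro h
    exact h2 ((Nat.prime_dvd_prime_iff_eq hp Nat.prime_two).1 (by exact_mod_cast h))
  have hpm : (p : ℤ) ∣ 4 * m ^ 2 + 1 :=
    (by push_cast; exact dvd_pow_self _ ha.ne' : (p : ℤ) ∣ ((p ^ a : ℕ) : ℤ)).trans hm
  push_cast at hm hn ⊢
  have hprod : (p : ℤ) ^ a ∣ (m - n) * (m + n) := by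
    have h4 : (p : ℤ) ^ a ∣ 4 * ((m - n) * (m + n)) := by
      have := dvd_sub hm hn
      have e : 4 * m ^ 2 + 1 - (4 * n ^ 2 + 1) = 4 * ((m - n) * (m + n)) := by ring
      rwa [e] at this
    refine IsCoprime.dvd_of_dvd_mul_left ?_ h4
    refine IsCoprime.pow_left ((Prime.coprime_iff_not_dvd hpZ).2 fun h => hp2 ?_)
    rw [show (4 : ℤ) = 2 * 2 by norm_num] at h
    rcases hpZ.dvd_or_dvd h with h | h <;> exact h
  by_cases h1 : (p : ℤ) ∣ m + n
  · right
    refine IsCoprime.dvd_of_dvd_mul_left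
      (IsCoprime.pow_left ((Prime.coprime_iff_not_dvd hpZ).2 fun h => ?_)) hprod
    -- otherwise `p` divides `2m`, hence `1 = (4m² + 1) - (2m)²`
    have h2m : (p : ℤ) ∣ 2 * m := by
      have := dvd_add h1 h
      rwa [show m + n + (m - n) = 2 * m by ring] at this
    have : (p : ℤ) ∣ 1 := by
      have := dvd_sub hpm (h2m.mul_left (2 * m))
      rwa [show 4 * m ^ 2 + 1 - 2 * m * (2 * m) = 1 by ring] at this
    exact hpZ.not_isUnit (isUnit_of_dvd_one this)
  · left
    exact IsCoprime.dvd_of_dvd_mul_right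
      (IsCoprime.pow_left ((Prime.coprime_iff_not_dvd hpZ).2 h1)) hprod

open Finset in
lemma card_pow_dvd_four_mul_sq_add_one_le {p a : ℕ} (hp : p.Prime) (h2 : p ≠ 2) (M : ℕ) :
    #{m ∈ Icc 1 M | p ^ a ∣ 4 * m ^ 2 + 1} ≤ 2 * (M / p ^ a) + 2 := by
  set s : Finset ℕ := {m ∈ Icc 1 M | p ^ a ∣ 4 * m ^ 2 + 1} with hs
  rcases s.eq_empty_or_nonempty with h | ⟨m₀, hm₀⟩
  · simp [h]
  -- two classes suffice, with `m₀` one fixed solution: those of `m₀` and of `-m₀`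
  have hle : ∀ m ∈ s, m ≤ M := fun m hm => (mem_Icc.1 (mem_filter.1 hm).1).2
  have hdvd : ∀ m ∈ s, ((p ^ a : ℕ) : ℤ) ∣ 4 * (m : ℤ) ^ 2 + 1 := fun m hm => by
    exact_mod_cast Int.natCast_dvd_natCast.2 (mem_filter.1 hm).2
  have hsub : s ⊆ (s.filter fun m : ℕ => ((p ^ a : ℕ) : ℤ) ∣ (m : ℤ) - m₀) ∪
      (s.filter fun m : ℕ => ((p ^ a : ℕ) : ℤ) ∣ (m : ℤ) + m₀) := fun m hm => by
    rw [← filter_or, mem_filter]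
    exact ⟨hm, pow_dvd_sub_or_pow_dvd_add hp h2 (hdvd m hm) (hdvd m₀ hm₀)⟩
  have h₁ : #(s.filter fun m : ℕ => ((p ^ a : ℕ) : ℤ) ∣ (m : ℤ) - m₀) ≤ M / p ^ a + 1 :=
    card_le_div_add_one_of_pairwise_dvd_sub (fun m hm => hle m (mem_filter.1 hm).1)
      fun m hm n hn => by
        simpa using dvd_sub (mem_filter.1 hm).2 (mem_filter.1 hn).2
  have h₂ : #(s.filter fun m : ℕ => ((p ^ a : ℕ) : ℤ) ∣ (m : ℤ) + m₀) ≤ M / p ^ a + 1 :=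
    card_le_div_add_one_of_pairwise_dvd_sub (fun m hm => hle m (mem_filter.1 hm).1)
      fun m hm n hn => by
        simpa using dvd_sub (mem_filter.1 hm).2 (mem_filter.1 hn).2
  have := (card_le_card hsub).trans (card_union_le _ _)
  omega

open Finset in
/-- Up to a defect of at most twice the exponent of the largest power of `p` not exceeding
`4M² + 1`, an odd prime divides `∏ (4m² + 1)` to no higher power than it divides `(M!)²`. -/
lemma factorization_prod_four_mul_sq_add_one_le {p : ℕ} (hp : p.Prime) (h2 : p ≠ 2) (M : ℕ) :
    (∏ m ∈ Icc 1 M, (4 * m ^ 2 + 1)).factorization p ≤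
      2 * (M.factorial).factorization p + 2 * Nat.log p (4 * M ^ 2 + 1) := by
  set b := Nat.log p (4 * M ^ 2 + 1) with hb
  have hterm : ∀ m ∈ Icc 1 M, (4 * m ^ 2 + 1).factorization p =
      ∑ i ∈ Ico 1 (b + 1), if p ^ i ∣ 4 * m ^ 2 + 1 then 1 else 0 := fun m hm => by
    rw [Nat.factorization_eq_card_pow_dvd_of_lt hp (b := b + 1) (by positivity), card_filter]
    refine lt_of_le_of_lt ?_ (Nat.lt_pow_succ_log_self hp.one_lt _)
    have := (mem_Icc.1 hm).2
    gcongr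
  have hlog : Nat.log p M < b + 1 := by
    refine Nat.lt_succ_of_le (Nat.log_mono_right ?_)
    nlinarith [Nat.zero_le M]
  rw [Nat.factorization_prod_apply (fun m _ => by positivity), sum_congr rfl hterm, sum_comm,
    Nat.factorization_factorial hp hlog]
  simp_rw [← card_filter]
  refine (sum_le_sum fun i _ => card_pow_dvd_four_mul_sq_add_one_le hp h2 M).trans ?_
  rw [sum_add_distrib, ← mul_sum]
  simp [mul_comm]

open Finset in
lemma four_pow_mul_factorial_sq_le_prod (M : ℕ) :
    4 ^ M * M.factorial ^ 2 ≤ ∏ m ∈ Icc 1 M, (4 * m ^ 2 + 1) := by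
  induction M with
  | zero => simp
  | succ M ih =>
    rw [← Finset.insert_Icc_right_eq_Icc_add_one (by omega), prod_insert (by simp),
      Nat.factorial_succ]
    calc 4 ^ (M + 1) * ((M + 1) * M.factorial) ^ 2
        = 4 * (M + 1) ^ 2 * (4 ^ M * M.factorial ^ 2) := by ring
      _ ≤ _ := Nat.mul_le_mul (Nat.le_succ _) ih

open Finset in
/-- A Chebyshev-type bound: many primes occur in `∏ (4m² + 1)`, because this product exceeds
`(M!)²` by a factor `4^M`. -/
lemma two_pow_le_pow_card_primeFactors (M : ℕ) :
    2 ^ M ≤ (4 * M ^ 2 + 1) ^ #(∏ m ∈ Icc 1 M, (4 * m ^ 2 + 1)).primeFactors := by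
  set N := ∏ m ∈ Icc 1 M, (4 * m ^ 2 + 1) with hN
  have hN0 : N ≠ 0 := prod_ne_zero_iff.2 fun m _ => by positivity
  have hodd : ∀ p ∈ N.primeFactors, p ≠ 2 := by
    rintro p hp rfl
    obtain ⟨m, -, hm⟩ :=
      (Nat.prime_two.prime.dvd_finsetProd_iff _).1 (Nat.dvd_of_mem_primeFactors hp)
    omega
  have hup : N ≤ M.factorial ^ 2 * (4 * M ^ 2 + 1) ^ (2 * #N.primeFactors) := by
    calc N = ∏ p ∈ N.primeFactors, p ^ N.factorization p :=
          (Nat.prod_factorization_pow_eq_self hN0).symm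
      _ ≤ ∏ p ∈ N.primeFactors,
            ((p ^ M.factorial.factorization p) ^ 2 * (4 * M ^ 2 + 1) ^ 2) := by
          refine prod_le_prod' fun p hp => ?_
          have hpp := Nat.prime_of_mem_primeFactors hp
          calc p ^ N.factorization p
              ≤ p ^ (2 * (M.factorial).factorization p + 2 * Nat.log p (4 * M ^ 2 + 1)) :=
                Nat.pow_le_pow_right hpp.pos
                  (factorization_prod_four_mul_sq_add_one_le hpp (hodd p hp) M)
            _ = (p ^ M.factorial.factorization p) ^ 2 * (p ^ Nat.log p (4 * M ^ 2 + 1)) ^ 2 := by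
                rw [pow_add, mul_comm 2, pow_mul, mul_comm 2, pow_mul]
            _ ≤ _ := by
                gcongr
                exact Nat.pow_log_le_self p (by positivity)
      _ = (∏ p ∈ N.primeFactors, p ^ M.factorial.factorization p) ^ 2 *
            (4 * M ^ 2 + 1) ^ (2 * #N.primeFactors) := by
          rw [prod_mul_distrib, prod_pow, prod_const, ← pow_mul]
      _ ≤ _ := by
          gcongr
          refine Nat.le_of_dvd (Nat.factorial_pos M) ?_
          rw [← Nat.factorization_le_iff_dvd (prod_ne_zero_iff.2 fun p hp =>
            pow_ne_zero _ (Nat.prime_of_mem_primeFactors hp).ne_zero) (Nat.factorial_ne_zero M)]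
          intro q
          rw [Nat.factorization_prod_apply fun p hp =>
            pow_ne_zero _ (Nat.prime_of_mem_primeFactors hp).ne_zero]
          by_cases hq : q ∈ N.primeFactors
          · rw [sum_eq_single_of_mem q hq]
            · simp [(Nat.prime_of_mem_primeFactors hq).factorization]
            · intro p hp hpq
              simp [(Nat.prime_of_mem_primeFactors hp).factorization, hpq]
          · rw [sum_eq_zero]
            · exact Nat.zero_le _
            · intro p hp
              have : p ≠ q := fun h => hq (h ▸ hp)
              simp [(Nat.prime_of_mem_primeFactors hp).factorization, this]
  have h := (four_pow_mul_factorial_sq_le_prod M).trans hup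
  rw [mul_comm] at h
  have h := Nat.le_of_mul_le_mul_left h (by positivity)
  rw [show 4 = 2 ^ 2 by norm_num, ← pow_mul, mul_comm 2 M, pow_mul, mul_comm 2, pow_mul] at h
  exact (Nat.pow_le_pow_iff_left two_ne_zero).1 h

open Finset in
/-- There are `k` odd primes of polynomial size in `k` that are sums of two squares, that is, not
`3` modulo `4`. -/
lemma exists_primes_mod_four_ne_three (k : ℕ) : ∃ P : Finset ℕ, #P = k ∧
    ∀ p ∈ P, p.Prime ∧ p ≠ 2 ∧ p % 4 ≠ 3 ∧ p ≤ 2 ^ 11 * k ^ 4 := by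
  rcases Nat.eq_zero_or_pos k with rfl | hk
  · exact ⟨∅, by simp⟩
  -- with this `M`, fewer than `k` prime factors would force `2 ^ (16 k) ≤ 1024 k⁴ + 1`
  set M := 16 * k ^ 2 with hM
  set N := ∏ m ∈ Icc 1 M, (4 * m ^ 2 + 1) with hN
  have hk4 : k ^ 4 ≤ 16 ^ k := by
    calc k ^ 4 ≤ (2 ^ k) ^ 4 := by gcongr; exact Nat.lt_two_pow_self.le
      _ = 16 ^ k := by rw [← pow_mul, mul_comm, pow_mul]; norm_num
  have hcard : k ≤ #N.primeFactors := by
    by_contra! hlt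
    have h1 : 2 ^ M ≤ (4 * M ^ 2 + 1) ^ k :=
      (two_pow_le_pow_card_primeFactors M).trans (Nat.pow_le_pow_right (by positivity) hlt.le)
    rw [show M = 16 * k * k by rw [hM]; ring, pow_mul] at h1
    have h2 := (Nat.pow_le_pow_iff_left hk.ne').1 h1
    rw [pow_mul] at h2
    have h3 : (2 ^ 16) ^ k = 16 ^ k * 4096 ^ k := by rw [← mul_pow]; norm_num
    have h4 : 4096 ≤ 4096 ^ k := Nat.le_self_pow hk.ne' _
    have h5 : 16 ^ k * 4096 ≤ 16 ^ k * 4096 ^ k := by gcongr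
    have h6 : 4 * (16 * k * k) ^ 2 + 1 = 1024 * k ^ 4 + 1 := by ring
    have h7 : 1 ≤ 16 ^ k := Nat.one_le_pow _ _ (by norm_num)
    omega
  obtain ⟨P, hP, hPk⟩ := exists_subset_card_eq hcard
  refine ⟨P, hPk, fun p hp => ?_⟩
  have hp' := hP hp
  have hpp := Nat.prime_of_mem_primeFactors hp'
  obtain ⟨m, hm, hdvd⟩ :=
    (hpp.prime.dvd_finsetProd_iff _).1 (Nat.dvd_of_mem_primeFactors hp')
  refine ⟨hpp, ?_, ?_, ?_⟩
  · rintro rfl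
    omega
  · have := Fact.mk hpp
    have h0 : ((4 * m ^ 2 + 1 : ℕ) : ZMod p) = 0 := (ZMod.natCast_eq_zero_iff _ _).2 hdvd
    refine ZMod.mod_four_ne_three_of_sq_eq_neg_one (y := 2 * (m : ZMod p)) ?_
    push_cast at h0
    linear_combination h0
  · have h1 : p ≤ 4 * m ^ 2 + 1 := Nat.le_of_dvd (by positivity) hdvd
    have h2 : m ≤ M := (mem_Icc.1 hm).2
    have h3 : 4 * m ^ 2 + 1 ≤ 4 * M ^ 2 + 1 := by gcongr
    have h4 : 4 * M ^ 2 + 1 = 2 ^ 10 * k ^ 4 + 1 := by rw [hM]; ring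
    have h5 : 1 ≤ k ^ 4 := Nat.one_le_pow _ _ hk
    omega

/-! ### Circles with many lattice points -/

/-- An odd prime `p = z z̄` splits into coprime conjugate Gaussian integers, as `gcd(z, z̄)` divides
both `z + z̄ = 2 Re z` and `p`. -/
lemma isCoprime_star_of_norm_eq_prime {p : ℕ} (hp : p.Prime) (h2 : p ≠ 2) {z : GaussianInt}
    (hz : z.norm = p) : IsCoprime z (star z) := by
  have hpZ : Prime (p : ℤ) := Nat.prime_iff_prime_int.1 hp
  have hnorm : z.re ^ 2 + z.im ^ 2 = p := by rw [← hz, Zsqrtd.norm_def]; ring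
  have hre : ¬ (p : ℤ) ∣ 2 * z.re := by
    intro h
    rcases hpZ.dvd_or_dvd h with h | h
    · exact h2 ((Nat.prime_dvd_prime_iff_eq hp Nat.prime_two).1 (by exact_mod_cast h))
    · have hp2 : (2 : ℤ) ≤ p := by exact_mod_cast hp.two_le
      have h0 : z.re = 0 := by
        by_contra h0
        have := Int.le_of_dvd (abs_pos.2 h0) ((dvd_abs _ _).2 h)
        nlinarith [sq_abs z.re, sq_nonneg z.im]
      rw [h0] at hnorm
      have hsq : z.im ^ 2 = p := by linarith
      have hpi : (p : ℤ) ∣ z.im := hpZ.dvd_of_dvd_pow (n := 2) (by rw [hsq])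
      have h0' : z.im ≠ 0 := by rintro h; rw [h] at hsq; norm_num at hsq; omega
      have := Int.le_of_dvd (abs_pos.2 h0') ((dvd_abs _ _).2 hpi)
      nlinarith [sq_abs z.im]
  obtain ⟨u, v, huv⟩ := (Prime.coprime_iff_not_dvd hpZ).2 hre
  have hsum : z + star z = ((2 * z.re : ℤ) : GaussianInt) := by
    ext <;> simp; ring
  have hmul : z * star z = ((p : ℤ) : GaussianInt) := by
    rw [← hz, Zsqrtd.norm_eq_mul_conj]
  refine ⟨(v : GaussianInt) + u * star z, v, ?_⟩
  have : ((u * p + v * (2 * z.re) : ℤ) : GaussianInt) = 1 := by rw [huv]; simp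
  rw [Int.cast_add, Int.cast_mul, Int.cast_mul v, ← hsum, ← hmul] at this
  rw [← this]
  ring

open Finset in
/-- A product of `k` distinct odd primes, none of them `3` modulo `4`, is the norm of at least
`2^k` Gaussian integers. -/
lemma exists_gaussianInt_norm_eq_prod (P : Finset ℕ)
    (hP : ∀ p ∈ P, p.Prime ∧ p ≠ 2 ∧ p % 4 ≠ 3) :
    ∃ S : Finset GaussianInt, #S = 2 ^ #P ∧ ∀ s ∈ S, s.norm = ((∏ p ∈ P, p : ℕ) : ℤ) := by
  classical
  induction P using Finset.induction_on with
  | empty => exact ⟨{1}, by simp⟩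
  | insert p P hpP ih =>
    obtain ⟨S, hcard, hS⟩ := ih fun q hq => hP q (mem_insert_of_mem hq)
    obtain ⟨hp, h2, h3⟩ := hP p (mem_insert_self _ _)
    have := Fact.mk hp
    obtain ⟨a, b, hab⟩ := Nat.Prime.sq_add_sq h3
    set z : GaussianInt := ⟨a, b⟩ with hzdef
    have hz : z.norm = p := by
      rw [Zsqrtd.norm_def, ← hab]; simp [hzdef]; ring
    have hz' : (star z).norm = p := by rw [Zsqrtd.norm_conj, hz]
    have hz0 : z ≠ 0 := by
      intro h; rw [h, Zsqrtd.norm_zero] at hz; exact hp.ne_zero (by exact_mod_cast hz.symm)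
    have hz0' : star z ≠ 0 := star_ne_zero.2 hz0
    have hdisj : Disjoint (S.image (z * ·)) (S.image (star z * ·)) := by
      rw [disjoint_left]
      intro w hw hw'
      obtain ⟨s, hs, rfl⟩ := mem_image.1 hw
      obtain ⟨t, ht, hst⟩ := mem_image.1 hw'
      -- `z` and its conjugate being coprime, `p = N(z)` would divide the norm of `t`
      have hdvd : z ∣ t := (isCoprime_star_of_norm_eq_prime hp h2 hz).dvd_of_dvd_mul_left
        (Dvd.intro s hst.symm)
      obtain ⟨c, rfl⟩ := hdvd
      have hn := hS _ ht
      rw [Zsqrtd.norm_mul, hz] at hn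
      have hpd : p ∣ ∏ q ∈ P, q := by
        exact_mod_cast (Dvd.intro _ hn : (p : ℤ) ∣ _)
      obtain ⟨q, hq, hpq⟩ := (hp.prime.dvd_finsetProd_iff _).1 hpd
      rw [Nat.prime_dvd_prime_iff_eq hp (hP q (mem_insert_of_mem hq)).1] at hpq
      exact hpP (hpq ▸ hq)
    refine ⟨S.image (z * ·) ∪ S.image (star z * ·), ?_, ?_⟩
    · rw [card_union_of_disjoint hdisj, card_image_of_injective _ (mul_right_injective₀ hz0),
        card_image_of_injective _ (mul_right_injective₀ hz0'), card_insert_of_notMem hpP, hcard]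
      ring
    · intro s hs
      rw [prod_insert hpP]
      rcases mem_union.1 hs with hs | hs
      · obtain ⟨t, ht, rfl⟩ := mem_image.1 hs
        rw [Zsqrtd.norm_mul, hz, hS t ht]; push_cast; ring
      · obtain ⟨t, ht, rfl⟩ := mem_image.1 hs
        rw [Zsqrtd.norm_mul, hz', hS t ht]; push_cast; ring

open Finset in
/-- Circles carrying `2^k` lattice points with squared radius at most `(2¹¹ k⁴)^k`. -/
lemma exists_many_gaussianInt_norm_eq (k : ℕ) : ∃ (E : ℕ) (S : Finset GaussianInt),
    0 < E ∧ E ≤ (2 ^ 11 * k ^ 4) ^ k ∧ #S = 2 ^ k ∧ ∀ s ∈ S, s.norm = (E : ℤ) := by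
  obtain ⟨P, hk, hP⟩ := exists_primes_mod_four_ne_three k
  obtain ⟨S, hS, hSn⟩ := exists_gaussianInt_norm_eq_prod P
    fun p hp => ⟨(hP p hp).1, (hP p hp).2.1, (hP p hp).2.2.1⟩
  refine ⟨∏ p ∈ P, p, S, prod_pos fun p hp => (hP p hp).1.pos, ?_, hk ▸ hS, hSn⟩
  rw [← hk]
  exact prod_le_pow_card _ _ _ fun p hp => hk ▸ (hP p hp).2.2.2

/-! ### Trigonometric polynomials as eigenfunctions -/

/-- The trigonometric polynomial `∑ a_j exp(i n_j · x)` on the torus, its frequencies `n_j` indexed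
by a finset. -/
noncomputable def trigPoly (d : ℕ) {ι : Type*} (s : Finset ι) (n : ι → Fin d → ℤ) (a : ι → ℂ) :
    Torus d → ℂ :=
  fun x => ∑ j ∈ s, a j * ∏ i, fourier (n j i) (x i)

lemma prod_fourier_toTorus {d : ℕ} (n : Fin d → ℤ) (x : EuclideanSpace ℝ (Fin d)) :
    ∏ i, (fourier (n i) (toTorus d x i) : ℂ) =
      Complex.exp (((∑ i, (n i : ℝ) * x i : ℝ) : ℂ) * Complex.I) := by
  rw [Complex.ofReal_sum, Finset.sum_mul, Complex.exp_sum]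
  refine Finset.prod_congr rfl fun i _ => ?_
  rw [toTorus, fourier_coe_apply]
  congr 1
  have : (Real.pi : ℂ) ≠ 0 := by exact_mod_cast Real.pi_ne_zero
  push_cast
  field_simp

lemma trigPoly_toTorus {d : ℕ} {ι : Type*} (s : Finset ι) (n : ι → Fin d → ℤ) (a : ι → ℂ)
    (x : EuclideanSpace ℝ (Fin d)) :
    trigPoly d s n a (toTorus d x) =
      ∑ j ∈ s, a j * Complex.exp (((∑ i, (n j i : ℝ) * x i : ℝ) : ℂ) * Complex.I) := by
  simp only [trigPoly, prod_fourier_toTorus]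

/-- The purely imaginary linear form `x ↦ i n · x`. -/
noncomputable def phase {d : ℕ} (n : Fin d → ℤ) : EuclideanSpace ℝ (Fin d) →L[ℝ] ℂ :=
  ∑ i, ((n i : ℂ) * Complex.I) • (Complex.ofRealCLM.comp (EuclideanSpace.proj i))

lemma phase_apply {d : ℕ} (n : Fin d → ℤ) (x : EuclideanSpace ℝ (Fin d)) :
    phase n x = ((∑ i, (n i : ℝ) * x i : ℝ) : ℂ) * Complex.I := by
  simp only [phase, sum_apply, Complex.ofReal_sum, Finset.sum_mul]
  refine Finset.sum_congr rfl fun i _ => ?_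
  simp
  ring

lemma contDiff_exp_phase {d : ℕ} (n : Fin d → ℤ) {m : WithTop ℕ∞} :
    ContDiff ℝ m fun x => Complex.exp (phase n x) :=
  (phase n).contDiff.cexp

lemma laplacian_exp_phase {d : ℕ} (n : Fin d → ℤ) (x : EuclideanSpace ℝ (Fin d)) :
    (Δ fun y => Complex.exp (phase n y)) x =
      -((∑ i, (n i : ℝ) ^ 2 : ℝ) : ℂ) * Complex.exp (phase n x) := by
  have h1 : ∀ y, HasFDerivAt (fun y => Complex.exp (phase n y))
      (Complex.exp (phase n y) • phase n) y := fun y => (phase n).hasFDerivAt.cexp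
  have h2 : fderiv ℝ (fun y => Complex.exp (phase n y)) =
      fun y => Complex.exp (phase n y) • phase n := funext fun y => (h1 y).fderiv
  have h3 : HasFDerivAt (fun y => Complex.exp (phase n y) • phase n)
      ((Complex.exp (phase n x) • phase n).smulRight (phase n)) x := by
    exact (h1 x).smul_const (phase n)
  rw [InnerProductSpace.laplacian_eq_iteratedFDeriv_orthonormalBasis _
    (EuclideanSpace.basisFun (Fin d) ℝ)]
  simp only [iteratedFDeriv_two_apply, h2, h3.fderiv]
  have hb : ∀ i, phase n (EuclideanSpace.single i 1) = (n i : ℂ) * Complex.I := fun i => by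
    rw [phase_apply]
    simp
  simp [hb]
  rw [Finset.sum_mul, ← Finset.sum_neg_distrib]
  refine Finset.sum_congr rfl fun i _ => ?_
  linear_combination (Complex.exp (phase n x) * (n i : ℂ) ^ 2) * Complex.I_sq

lemma trigPoly_comp_toTorus {d : ℕ} {ι : Type*} (s : Finset ι) (n : ι → Fin d → ℤ) (a : ι → ℂ) :
    trigPoly d s n a ∘ toTorus d = fun x => ∑ j ∈ s, a j * Complex.exp (phase (n j) x) := by
  funext x
  simp only [Function.comp_apply, trigPoly_toTorus, phase_apply]

lemma laplacian_sum_exp_phase {d : ℕ} {ι : Type*} (s : Finset ι) (n : ι → Fin d → ℤ) (a : ι → ℂ)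
    (x : EuclideanSpace ℝ (Fin d)) :
    (Δ fun y => ∑ j ∈ s, a j * Complex.exp (phase (n j) y)) x =
      ∑ j ∈ s, -((∑ i, (n j i : ℝ) ^ 2 : ℝ) : ℂ) * (a j * Complex.exp (phase (n j) x)) := by
  classical
  induction s using Finset.induction_on with
  | empty => simp
  | insert j s hj ih =>
    simp only [Finset.sum_insert hj]
    have hc : ContDiff ℝ 2 fun y => a j * Complex.exp (phase (n j) y) :=
      contDiff_const.mul (contDiff_exp_phase (n j))
    have hs : ContDiff ℝ 2 fun y => ∑ j ∈ s, a j * Complex.exp (phase (n j) y) :=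
      ContDiff.sum fun j _ => contDiff_const.mul (contDiff_exp_phase (n j))
    have hadd := hc.contDiffAt.laplacian_add (hs.contDiffAt (x := x))
    have hsmul := InnerProductSpace.laplacian_smul (a j)
      (contDiff_exp_phase (n j)).contDiffAt (x := x)
    rw [laplacian_exp_phase] at hsmul
    refine hadd.trans ?_
    rw [ih]
    congr 1
    refine hsmul.trans ?_
    rw [smul_eq_mul]
    ring

lemma isEigenfunction_trigPoly {d : ℕ} {ι : Type*} {s : Finset ι} {n : ι → Fin d → ℤ} {a : ι → ℂ}
    {lam : ℝ} (h : ∀ j ∈ s, ∑ i, (n j i : ℝ) ^ 2 = lam ^ 2) :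
    IsEigenfunction d lam (trigPoly d s n a) := by
  refine ⟨?_, fun x => ?_⟩
  · rw [trigPoly_comp_toTorus]
    exact ContDiff.sum fun j _ => contDiff_const.mul (contDiff_exp_phase (n j))
  · rw [trigPoly_comp_toTorus, laplacian_sum_exp_phase,
      ← Function.comp_apply (f := trigPoly d s n a), trigPoly_comp_toTorus,
      ← Finset.sum_neg_distrib, Finset.mul_sum]
    refine Finset.sum_congr rfl fun j hj => ?_
    rw [h j hj, neg_mul, neg_neg]

/-! ### The `L²` norm of trigonometric polynomials -/

lemma integral_fourier (n : ℤ) :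
    ∫ x : AddCircle (2 * Real.pi), (fourier n x : ℂ) =
      if n = 0 then ((2 * Real.pi : ℝ) : ℂ) else 0 := by
  split_ifs with h
  · subst h
    simp only [fourier_zero, integral_const, measureReal_def, AddCircle.measure_univ,
      ENNReal.toReal_ofReal Real.two_pi_pos.le]
    simp
  · exact integral_eq_zero_of_add_right_eq_neg (μ := volume)
      (fourier_add_half_inv_index h Real.two_pi_pos)

lemma integral_prod_fourier_mul_conj {d : ℕ} (m n : Fin d → ℤ) :
    ∫ x : Torus d, (∏ i, (fourier (m i) (x i) : ℂ)) *
        (starRingEnd ℂ) (∏ i, (fourier (n i) (x i) : ℂ)) =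
      if m = n then (((2 * Real.pi) ^ d : ℝ) : ℂ) else 0 := by
  have h : ∀ x : Torus d, (∏ i, (fourier (m i) (x i) : ℂ)) *
      (starRingEnd ℂ) (∏ i, (fourier (n i) (x i) : ℂ)) = ∏ i, (fourier (m i - n i) (x i) : ℂ) := by
    intro x
    rw [map_prod, ← Finset.prod_mul_distrib]
    refine Finset.prod_congr rfl fun i _ => ?_
    rw [sub_eq_add_neg, fourier_add, fourier_neg]
  simp_rw [h]
  rw [integral_fintype_prod_volume_eq_prod
    (f := fun i (y : AddCircle (2 * Real.pi)) => (fourier (m i - n i) y : ℂ))]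
  simp_rw [integral_fourier]
  split_ifs with hmn
  · subst hmn; simp
  · obtain ⟨i, hi⟩ := Function.ne_iff.1 hmn
    exact Finset.prod_eq_zero (Finset.mem_univ i) (if_neg (sub_ne_zero.2 hi))

lemma continuous_prod_fourier {d : ℕ} (n : Fin d → ℤ) :
    Continuous fun x : Torus d => ∏ i, (fourier (n i) (x i) : ℂ) :=
  continuous_finsetProd _ fun i _ => (fourier (n i)).continuous.comp (continuous_apply i)

lemma integral_norm_trigPoly_sq {d : ℕ} {ι : Type*} {s : Finset ι} {n : ι → Fin d → ℤ}
    (hn : Set.InjOn n s) (a : ι → ℂ) :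
    ∫ x, ‖trigPoly d s n a x‖ ^ 2 = (2 * Real.pi) ^ d * ∑ j ∈ s, ‖a j‖ ^ 2 := by
  have hexp : ∀ x, ((‖trigPoly d s n a x‖ ^ 2 : ℝ) : ℂ) =
      ∑ j ∈ s, ∑ k ∈ s, (a j * (starRingEnd ℂ) (a k)) * ((∏ i, (fourier (n j i) (x i) : ℂ)) *
        (starRingEnd ℂ) (∏ i, (fourier (n k i) (x i) : ℂ))) := fun x => by
    rw [Complex.ofReal_pow, ← Complex.mul_conj', trigPoly, map_sum, Finset.sum_mul_sum]
    refine Finset.sum_congr rfl fun j _ => Finset.sum_congr rfl fun k _ => ?_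
    rw [map_mul]
    ring
  have hint : ∀ j k, Integrable fun x : Torus d => (a j * (starRingEnd ℂ) (a k)) *
      ((∏ i, (fourier (n j i) (x i) : ℂ)) * (starRingEnd ℂ) (∏ i, (fourier (n k i) (x i) : ℂ))) :=
    fun j k => Continuous.integrable_of_hasCompactSupport (continuous_const.mul
      ((continuous_prod_fourier (n j)).mul
        (Complex.continuous_conj.comp (continuous_prod_fourier (n k)))))
      (HasCompactSupport.of_compactSpace _)
  rw [← Complex.ofReal_inj, ← integral_complex_ofReal]
  simp_rw [hexp]
  rw [integral_finsetSum _ fun j _ => integrable_finsetSum _ fun k _ => hint j k]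
  rw [Complex.ofReal_mul, Complex.ofReal_sum, Finset.mul_sum]
  refine Finset.sum_congr rfl fun j hj => ?_
  rw [integral_finsetSum _ fun k _ => hint j k, Finset.sum_eq_single_of_mem j hj]
  · rw [integral_const_mul, integral_prod_fourier_mul_conj, if_pos rfl, Complex.mul_conj']
    push_cast
    ring
  · intro k hk hkj
    rw [integral_const_mul, integral_prod_fourier_mul_conj, if_neg, mul_zero]
    exact fun h => hkj (hn hk hj h.symm)

/-! ### Quantum limits from eigenfunctions of equal modulus -/

/-- If the moduli of a sequence of normalized eigenfunctions do not depend on the index, then their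
common density is a quantum limit, and bounds on it give bounds on `minMass`. -/
lemma minMass_le_of_norm_eq {d : ℕ} {lam : ℕ → ℝ} {u : ℕ → Torus d → ℂ}
    (hu : ∀ j, IsEigenfunction d (lam j) (u j)) (hlam : Tendsto lam atTop atTop)
    (hnorm : ∀ j x, ‖u j x‖ = ‖u 0 x‖) (hone : ∫ x, ‖u 0 x‖ ^ 2 = 1) {r c : ℝ}
    (hc : ∀ x : EuclideanSpace ℝ (Fin d), ‖x‖ < r → ‖u 0 (toTorus d x)‖ ^ 2 ≤ c) :
    minMass d r ≤ ENNReal.ofReal c := by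
  have hsq : ∀ x, ‖u 0 x‖ₑ ^ 2 = ENNReal.ofReal (‖u 0 x‖ ^ 2) := fun x => by
    rw [ENNReal.ofReal_pow (norm_nonneg _), ofReal_norm]
  have hdens : ∀ j, densityMeasure d (u j) = densityMeasure d (u 0) := fun j => by
    have : (fun x => ‖u j x‖ₑ ^ 2) = fun x => ‖u 0 x‖ₑ ^ 2 := by
      funext x
      rw [← ofReal_norm, hnorm j x, ofReal_norm]
    rw [densityMeasure, this, densityMeasure]
  have hprob : IsProbabilityMeasure (densityMeasure d (u 0)) := by
    constructor
    rw [densityMeasure, withDensity_apply _ MeasurableSet.univ, Measure.restrict_univ]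
    simp_rw [hsq]
    rw [← ofReal_integral_eq_lintegral_ofReal (integrable_of_integral_eq_one hone)
      (Eventually.of_forall fun x => sq_nonneg _), hone, ENNReal.ofReal_one]
  let μ : ProbabilityMeasure (Torus d) := ⟨densityMeasure d (u 0), hprob⟩
  have hμ : μ ∈ quantumLimits d :=
    ⟨lam, u, fun _ => μ, hu, fun j => by simp_rw [hnorm j]; exact hone, fun j => (hdens j).symm,
      hlam, tendsto_const_nhds⟩
  refine (iInf₂_le μ hμ).trans (ENNReal.div_le_of_le_mul ?_)
  change densityMeasure d (u 0) _ ≤ _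
  rw [densityMeasure, withDensity_apply' _ (torusBall d r), ← setLIntegral_const]
  refine setLIntegral_mono measurable_const ?_
  rintro _ ⟨x, hx, rfl⟩
  rw [hsq]
  exact ENNReal.ofReal_le_ofReal (hc x (by simpa using hx))

/-! ### Vanishing of high order at the origin -/

open Finset Polynomial in
/-- On a circle `‖z‖² = E` carrying at least `2K` points of `S`, some non-trivial combination of
the points annihilates all powers below the `K`-th of all linear forms: on the circle these powers
are Laurent polynomials in `z` with exponents in `[-(K-1), K-1]`, which amounts to only `2K - 1`
linear conditions. -/
lemma exists_ne_zero_sum_mul_pow_eq_zero {S : Finset GaussianInt} {E K : ℕ} (hE : 0 < E)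
    (hS : ∀ s ∈ S, s.norm = (E : ℤ)) (hK : 2 * K ≤ #S) (hK0 : 0 < K) :
    ∃ a : GaussianInt → ℂ, (∃ s ∈ S, a s ≠ 0) ∧ ∀ (x y : ℝ), ∀ m < K,
      ∑ s ∈ S, a s * ((s.re * x + s.im * y : ℝ) : ℂ) ^ m = 0 := by
  classical
  let z : GaussianInt → ℂ := fun s => s.re + s.im * Complex.I
  let zbar : GaussianInt → ℂ := fun s => s.re - s.im * Complex.I
  have hzz : ∀ s ∈ S, z s * zbar s = E := fun s hs => by
    have h := hS s hs
    rw [Zsqrtd.norm_def] at h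
    have h' : (s.re : ℂ) * s.re - (-1) * s.im * s.im = E := by exact_mod_cast h
    simp only [z, zbar]
    linear_combination h' - (s.im : ℂ) ^ 2 * Complex.I_sq
  have hz0 : ∀ s ∈ S, z s ≠ 0 := fun s hs h => by
    have := hzz s hs
    rw [h, zero_mul] at this
    exact hE.ne' (by exact_mod_cast this.symm)
  let A : Matrix (Fin (2 * K - 1)) S ℂ := fun t s => (z s ^ (K - 1))⁻¹ * z s ^ (t : ℕ)
  have hker : LinearMap.ker A.mulVecLin ≠ ⊥ := by
    refine LinearMap.ker_ne_bot_of_finrank_lt ?_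
    simp
    omega
  obtain ⟨f, hf, hf0⟩ := Submodule.exists_mem_ne_zero_of_ne_bot hker
  rw [LinearMap.mem_ker, Matrix.mulVecLin_apply] at hf
  obtain ⟨s₀, hs₀⟩ := Function.ne_iff.1 hf0
  refine ⟨fun s => if h : s ∈ S then f ⟨s, h⟩ else 0, ⟨s₀, s₀.2, by simpa using hs₀⟩, ?_⟩
  intro x y m hm
  have hmono : ∀ t < 2 * K - 1, ∑ s : S, f s * ((z s ^ (K - 1))⁻¹ * z s ^ t) = 0 := fun t ht => by
    have := congrFun hf ⟨t, ht⟩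
    simp only [Matrix.mulVec, dotProduct, A, Pi.zero_apply] at this
    simpa [mul_comm] using this
  have hpoly : ∀ p : ℂ[X], p.natDegree < 2 * K - 1 →
      ∑ s : S, f s * ((z s ^ (K - 1))⁻¹ * p.eval (z s)) = 0 := fun p hp => by
    simp_rw [eval_eq_sum_range' hp, mul_sum]
    rw [sum_comm]
    refine sum_eq_zero fun t ht => ?_
    calc _ = p.coeff t * ∑ s : S, f s * ((z s ^ (K - 1))⁻¹ * z s ^ t) := by
          rw [mul_sum]
          exact sum_congr rfl fun s _ => by ring
      _ = 0 := by rw [hmono t (mem_range.1 ht), mul_zero]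
  -- the Laurent polynomial `(2 (x Re z + y Im z))^m = (w̄ z + w E z⁻¹)^m`, multiplied by `z^(K-1)`
  set w : ℂ := x + y * Complex.I with hw
  set wbar : ℂ := x - y * Complex.I with hwbar
  set p : ℂ[X] := X ^ (K - 1 - m) * (C wbar * X ^ 2 + C (E * w)) ^ m with hp
  have hdeg : p.natDegree < 2 * K - 1 := by
    have h1 : (C wbar * X ^ 2 + C (E * w)).natDegree ≤ 2 := by compute_degree
    have h2 : p.natDegree ≤ (K - 1 - m) + m * 2 := by
      refine natDegree_mul_le.trans (add_le_add (natDegree_X_pow_le _) ?_)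
      exact natDegree_pow_le.trans (Nat.mul_le_mul_left _ h1)
    omega
  have hval : ∀ s ∈ S, (z s ^ (K - 1))⁻¹ * p.eval (z s) =
      2 ^ m * ((s.re * x + s.im * y : ℝ) : ℂ) ^ m := fun s hs => by
    have hb : wbar * z s ^ 2 + E * w = z s * (2 * ((s.re * x + s.im * y : ℝ) : ℂ)) := by
      rw [← hzz s hs]
      simp only [z, zbar, hw, hwbar]
      push_cast
      linear_combination (-2 * (s.re + s.im * Complex.I) * (s.im : ℂ) * y) * Complex.I_sq
    simp only [hp, eval_mul, eval_pow, eval_X, eval_add, eval_C]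
    rw [hb, mul_pow, ← mul_assoc (z s ^ (K - 1 - m)), ← pow_add,
      show K - 1 - m + m = K - 1 by omega, ← mul_assoc,
      inv_mul_cancel₀ (pow_ne_zero _ (hz0 s hs)), one_mul, mul_pow]
  have h := hpoly p hdeg
  rw [← sum_coe_sort S]
  have h2 : (2 : ℂ) ^ m ≠ 0 := pow_ne_zero _ two_ne_zero
  refine (mul_eq_zero.1 ?_).resolve_left h2
  rw [mul_sum]
  refine Eq.trans (sum_congr rfl fun s _ => ?_) h
  simp only [hval s s.2, dif_pos s.2, Subtype.coe_eta]
  ring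

open Finset in
/-- If the power sums `∑ a_j t_j^m` vanish for `m < K`, then so does the Taylor polynomial of
`∑ a_j exp(i t_j)`, which leaves a remainder of order `K`. -/
lemma norm_sum_mul_exp_sq_le {ι : Type*} {s : Finset ι} {a : ι → ℂ} {t : ι → ℝ} {K : ℕ} {δ : ℝ}
    (hK : 0 < K) (hδ : δ ≤ 1) (ht : ∀ j ∈ s, |t j| ≤ δ)
    (ha : ∀ m < K, ∑ j ∈ s, a j * (t j : ℂ) ^ m = 0) :
    ‖∑ j ∈ s, a j * Complex.exp (t j * Complex.I)‖ ^ 2 ≤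
      4 * δ ^ (2 * K) * (#s * ∑ j ∈ s, ‖a j‖ ^ 2) := by
  rcases s.eq_empty_or_nonempty with rfl | ⟨j₀, hj₀⟩
  · simp
  have hδ0 : 0 ≤ δ := (abs_nonneg _).trans (ht j₀ hj₀)
  have hTaylor : ∑ j ∈ s, a j * ∑ m ∈ range K, (t j * Complex.I) ^ m / (m.factorial : ℂ) = 0 := by
    simp_rw [mul_sum]
    rw [sum_comm]
    refine sum_eq_zero fun m hm => ?_
    calc _ = Complex.I ^ m / (m.factorial : ℂ) * ∑ j ∈ s, a j * (t j : ℂ) ^ m := by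
          rw [mul_sum]
          refine sum_congr rfl fun j _ => ?_
          rw [mul_pow]
          ring
      _ = 0 := by rw [ha m (mem_range.1 hm), mul_zero]
  have hterm : ∀ j ∈ s, ‖Complex.exp (t j * Complex.I) -
      ∑ m ∈ range K, (t j * Complex.I) ^ m / (m.factorial : ℂ)‖ ≤ 2 * δ ^ K := fun j hj => by
    have hn : ‖(t j : ℂ) * Complex.I‖ ≤ δ := by simpa using ht j hj
    have hK1 : (1 : ℝ) ≤ K := by exact_mod_cast hK
    refine (Complex.exp_bound' ?_).trans ?_
    · rw [div_le_iff₀ (by positivity)]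
      push_cast
      linarith
    · have h1 : ‖(t j : ℂ) * Complex.I‖ ^ K ≤ δ ^ K := by gcongr
      have h2 : ‖(t j : ℂ) * Complex.I‖ ^ K / (K.factorial : ℝ) ≤ ‖(t j : ℂ) * Complex.I‖ ^ K :=
        div_le_self (by positivity) (by exact_mod_cast K.factorial_pos)
      linarith
  have hsum : ‖∑ j ∈ s, a j * Complex.exp (t j * Complex.I)‖ ≤ 2 * δ ^ K * ∑ j ∈ s, ‖a j‖ := by
    rw [← sub_zero (∑ j ∈ s, a j * Complex.exp (t j * Complex.I)), ← hTaylor, ← sum_sub_distrib,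
      mul_sum]
    refine norm_sum_le_of_le _ fun j hj => ?_
    rw [← mul_sub, norm_mul, mul_comm]
    exact mul_le_mul_of_nonneg_right (hterm j hj) (norm_nonneg _)
  calc _ ≤ (2 * δ ^ K * ∑ j ∈ s, ‖a j‖) ^ 2 := by gcongr
    _ = 4 * δ ^ (2 * K) * (∑ j ∈ s, ‖a j‖) ^ 2 := by ring
    _ ≤ _ := by
      gcongr
      exact sq_sum_le_card_mul_sum_sq

/-! ### Mass bounds in dimension three -/

open Finset in
/-- Lattice points on a circle of squared radius `E ≤ (δ/r)²` produce quantum limits of small mass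
in the ball of radius `r`. -/
lemma minMass_three_le {S : Finset GaussianInt} {E K : ℕ} (hE : 0 < E)
    (hS : ∀ s ∈ S, s.norm = (E : ℤ)) (hK : 2 * K ≤ #S) (hK0 : 0 < K) {r δ : ℝ}
    (hδ0 : 0 ≤ δ) (hδ : δ ≤ 1) (hEr : E * r ^ 2 ≤ δ ^ 2) :
    minMass 3 r ≤ ENNReal.ofReal (4 * δ ^ (2 * K) * #S) := by
  obtain ⟨a, ⟨s₀, hs₀, ha₀⟩, ha⟩ := exists_ne_zero_sum_mul_pow_eq_zero hE hS hK hK0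
  set σ : ℝ := (2 * Real.pi) ^ 3 * ∑ s ∈ S, ‖a s‖ ^ 2 with hσ
  have hA : 0 < ∑ s ∈ S, ‖a s‖ ^ 2 :=
    sum_pos' (fun s _ => sq_nonneg _) ⟨s₀, hs₀, by positivity⟩
  have hσ0 : 0 < σ := by positivity
  let b : GaussianInt → ℂ := fun s => ((Real.sqrt σ)⁻¹ : ℝ) * a s
  have hb2 : ∀ s, ‖b s‖ ^ 2 = σ⁻¹ * ‖a s‖ ^ 2 := fun s => by
    simp only [b]
    rw [norm_mul, mul_pow, Complex.norm_real, Real.norm_eq_abs, sq_abs, inv_pow,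
      Real.sq_sqrt hσ0.le]
  have hbsum : (2 * Real.pi) ^ 3 * ∑ s ∈ S, ‖b s‖ ^ 2 = 1 := by
    simp_rw [hb2]
    rw [← mul_sum, mul_left_comm, ← hσ, inv_mul_cancel₀ hσ0.ne']
  let n : ℕ → GaussianInt → Fin 3 → ℤ := fun j s => ![s.re, s.im, j]
  have hinj : Set.InjOn (n 0) S := fun s _ t _ hst => by
    have h0 := congrFun hst 0
    have h1 := congrFun hst 1
    simp only [n, Matrix.cons_val_zero, Matrix.cons_val_one] at h0 h1
    exact Zsqrtd.ext h0 h1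
  have hnE : ∀ s ∈ S, (s.re : ℝ) ^ 2 + (s.im : ℝ) ^ 2 = E := fun s hs => by
    have h := hS s hs
    rw [Zsqrtd.norm_def] at h
    have h' : (s.re : ℝ) * s.re - (-1) * s.im * s.im = E := by exact_mod_cast h
    linarith
  -- `j` enters only as the third frequency, so that `S` selects `v` on the two-dimensional torus
  refine minMass_le_of_norm_eq (lam := fun j => Real.sqrt (E + (j : ℝ) ^ 2))
    (u := fun j => trigPoly 3 S (n j) b) (fun j => ?_) ?_ (fun j x => ?_) ?_ fun x hx => ?_
  · refine isEigenfunction_trigPoly fun s hs => ?_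
    rw [Real.sq_sqrt (by positivity), ← hnE s hs, Fin.sum_univ_three]
    simp [n]
  · refine tendsto_atTop_mono (fun j => ?_) tendsto_natCast_atTop_atTop
    exact Real.le_sqrt_of_sq_le (by linarith [(Nat.cast_nonneg E : (0 : ℝ) ≤ E)])
  · -- the `j`-th function is the `0`-th one times the character `exp(i j x₃)`
    have : ∀ j, trigPoly 3 S (n j) b x = fourier (j : ℤ) (x 2) * trigPoly 3 S (n 0) b x := by
      intro j
      simp only [trigPoly, mul_sum]
      refine sum_congr rfl fun s _ => ?_
      simp only [Fin.prod_univ_three, n, Matrix.cons_val_zero, Matrix.cons_val_one,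
        Matrix.cons_val_two, Matrix.tail_cons, Matrix.head_cons]
      simp
      ring
    have h1 : ‖fourier (j : ℤ) (x 2)‖ = 1 := by rw [fourier_apply, Circle.norm_coe]
    simp only [this j, norm_mul, h1, one_mul]
  · rw [integral_norm_trigPoly_sq hinj, hbsum]
  · rw [trigPoly_toTorus]
    have ht : ∀ s : GaussianInt, (∑ i, ((n 0 s i : ℤ) : ℝ) * x i) = s.re * x 0 + s.im * x 1 :=
      fun s => by simp [Fin.sum_univ_three, n]
    simp_rw [ht]
    have hx2 : x 0 ^ 2 + x 1 ^ 2 ≤ r ^ 2 := by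
      have h1 := EuclideanSpace.norm_sq_eq x
      rw [Fin.sum_univ_three] at h1
      simp only [Real.norm_eq_abs, sq_abs] at h1
      have h2 : ‖x‖ ^ 2 ≤ r ^ 2 := by gcongr
      nlinarith [sq_nonneg (x 2)]
    refine (norm_sum_mul_exp_sq_le hK0 hδ (fun s hs => ?_) fun m hm => ?_).trans ?_
    · refine abs_le_of_sq_le_sq ?_ hδ0
      refine le_trans ?_ hEr
      rw [← hnE s hs]
      have := mul_le_mul_of_nonneg_left hx2
        (by positivity : (0 : ℝ) ≤ (s.re : ℝ) ^ 2 + (s.im : ℝ) ^ 2)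
      nlinarith [sq_nonneg ((s.re : ℝ) * x 1 - s.im * x 0)]
    · simp only [b, mul_assoc]
      rw [← mul_sum, ha (x 0) (x 1) m hm, mul_zero]
    · have hle : ∑ s ∈ S, ‖b s‖ ^ 2 ≤ 1 := by
        have h2 : (1 : ℝ) ≤ (2 * Real.pi) ^ 3 :=
          one_le_pow₀ (by linarith [Real.two_le_pi])
        have h3 : 0 ≤ ∑ s ∈ S, ‖b s‖ ^ 2 := sum_nonneg fun s _ => sq_nonneg _
        nlinarith
      have := mul_le_mul_of_nonneg_left hle
        (by positivity : 0 ≤ 4 * δ ^ (2 * K) * (#S : ℝ))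
      linarith

/-- The normalized Lebesgue measure is a quantum limit. -/
lemma minMass_le_one (d : ℕ) (hd : 0 < d) (r : ℝ) : minMass d r ≤ 1 := by
  have hpos : (0 : ℝ) < (2 * Real.pi) ^ d := by positivity
  let b : Unit → ℂ := fun _ => ((Real.sqrt ((2 * Real.pi) ^ d))⁻¹ : ℝ)
  have hb : ‖b ()‖ ^ 2 = ((2 * Real.pi) ^ d)⁻¹ := by
    simp only [b]
    rw [Complex.norm_real, Real.norm_eq_abs, sq_abs, inv_pow, Real.sq_sqrt hpos.le]
  let n : ℕ → Unit → Fin d → ℤ := fun j _ => Pi.single ⟨0, hd⟩ (j : ℤ)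
  have hnorm : ∀ j x, ‖trigPoly d Finset.univ (n j) b x‖ = ‖b ()‖ := fun j x => by
    have h1 : ∀ i, ‖fourier (n j () i) (x i)‖ = 1 := fun i => by rw [fourier_apply, Circle.norm_coe]
    simp [trigPoly, h1, -fourier_apply]
  rw [← ENNReal.ofReal_one]
  refine minMass_le_of_norm_eq (lam := fun j => (j : ℝ))
    (u := fun j => trigPoly d Finset.univ (n j) b) (fun j => ?_) tendsto_natCast_atTop_atTop
    (fun j x => ?_) ?_ fun x _ => ?_
  · refine isEigenfunction_trigPoly fun s _ => ?_
    rw [Finset.sum_eq_single_of_mem ⟨0, hd⟩ (Finset.mem_univ _)]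
    · simp [n]
    · intro i _ hi
      simp [n, hi]
  · rw [hnorm, hnorm]
  · rw [integral_norm_trigPoly_sq fun _ _ _ _ _ => rfl, Fintype.sum_unique,
      ← mul_inv_cancel₀ hpos.ne']
    exact congrArg _ hb
  · rw [hnorm, hb]
    exact inv_le_one_of_one_le₀ (one_le_pow₀ (by linarith [Real.two_le_pi]))

/-! ### The choice of parameters -/

/-- The case `K = 2^(k-1)`, `δ = e⁻²` of `minMass_three_le`, on a circle with `2^k` lattice
points. -/
lemma minMass_three_le_exp_neg_two_pow {k : ℕ} (hk : 0 < k) {r : ℝ}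
    (hr : ((2 ^ 11 * k ^ 4) ^ k : ℝ) * r ^ 2 ≤ Real.exp (-4)) :
    minMass 3 r ≤ ENNReal.ofReal (4 * Real.exp (-2 ^ k)) := by
  obtain ⟨E, S, hE, hEle, hcard, hS⟩ := exists_many_gaussianInt_norm_eq k
  have h2K : 2 * 2 ^ (k - 1) = 2 ^ k := by rw [← pow_succ', Nat.sub_add_cancel hk]
  have hEr : (E : ℝ) * r ^ 2 ≤ Real.exp (-2) ^ 2 := by
    rw [← Real.exp_nat_mul]
    norm_num
    refine le_trans (mul_le_mul_of_nonneg_right ?_ (sq_nonneg r)) hr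
    exact_mod_cast hEle
  refine (minMass_three_le (K := 2 ^ (k - 1)) hE hS (by rw [hcard, h2K]) (by positivity)
    (Real.exp_pos _).le (Real.exp_le_one_iff.2 (by norm_num)) hEr).trans
    (ENNReal.ofReal_le_ofReal ?_)
  rw [h2K, hcard, ← Real.exp_nat_mul, mul_assoc]
  push_cast
  have h1 : ((2 : ℝ) ^ k) ≤ Real.exp (2 ^ k) := by linarith [Real.add_one_le_exp ((2 : ℝ) ^ k)]
  calc 4 * (Real.exp (2 ^ k * -2) * 2 ^ k) ≤ 4 * (Real.exp (2 ^ k * -2) * Real.exp (2 ^ k)) := by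
        gcongr
    _ = _ := by
        rw [← Real.exp_add]
        ring_nf

/-- With `L = log (1/r)` and `k ≈ L / (20 log L)`, the circle has `log E ≤ 0.6 L`, and
`2^k ≥ exp (L / (80 log L))`. -/
lemma minMass_three_le_of_large {r : ℝ} (hr : 0 < r) (hL : 6400 ≤ Real.log (1 / r)) :
    minMass 3 r ≤ ENNReal.ofReal (4 * Real.exp (-Real.exp
      (1 / 80 * Real.log (1 / r) / Real.log (Real.log (1 / r))))) := by
  set L := Real.log (1 / r) with hLdef
  have hL0 : 0 < L := by linarith
  set l := Real.log L with hl
  have hl1 : 1 ≤ l := by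
    rw [hl, Real.le_log_iff_exp_le hL0]
    linarith [Real.exp_one_lt_d9]
  -- `log L = 2 log √L ≤ 2 √L`, and `√L ≥ 80`
  have hlL : l ≤ L / 40 := by
    have h1 : 80 ≤ Real.sqrt L := Real.le_sqrt_of_sq_le (by linarith)
    have h2 : l = 2 * Real.log (Real.sqrt L) := by rw [Real.log_sqrt hL0.le]; ring
    have h3 := Real.log_le_sub_one_of_pos (by linarith : 0 < Real.sqrt L)
    have h4 := Real.mul_self_sqrt hL0.le
    nlinarith
  set X := L / l with hX
  have hXl : X * l = L := div_mul_cancel₀ _ (by linarith)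
  have hX40 : 40 ≤ X := by
    rw [hX, le_div_iff₀ (by linarith)]
    linarith
  set k := ⌊X / 20⌋₊ with hk
  have hkle : (k : ℝ) ≤ X / 20 := Nat.floor_le (by linarith)
  have hklt : X / 20 < k + 1 := Nat.lt_floor_add_one _
  have hk1 : (1 : ℝ) < k := by linarith
  have hk0 : 0 < k := by exact_mod_cast (zero_lt_one.trans hk1)
  have hkL : (k : ℝ) ≤ L := by nlinarith
  have hlogk : Real.log k ≤ l := Real.log_le_log (by linarith) hkL
  have hr2 : r ^ 2 = Real.exp (-(2 * L)) := by
    rw [hLdef, Real.log_div one_ne_zero hr.ne', Real.log_one, ← Real.exp_log (pow_pos hr 2),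
      Real.log_pow]
    congr 1
    push_cast
    ring
  have hE : ((2 ^ 11 * k ^ 4) ^ k : ℝ) = Real.exp (k * (11 * Real.log 2 + 4 * Real.log k)) := by
    rw [← Real.exp_log (by positivity : (0 : ℝ) < (2 ^ 11 * k ^ 4) ^ k), Real.log_pow,
      Real.log_mul (by positivity) (by positivity), Real.log_pow, Real.log_pow]
    push_cast
    rfl
  refine (minMass_three_le_exp_neg_two_pow hk0 ?_).trans (ENNReal.ofReal_le_ofReal ?_)
  · rw [hE, hr2, ← Real.exp_add, Real.exp_le_exp]
    have h1 : 11 * Real.log 2 + 4 * Real.log k ≤ 12 * l := by linarith [Real.log_two_lt_d9]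
    have h2 : k * (11 * Real.log 2 + 4 * Real.log k) ≤ X / 20 * (12 * l) :=
      mul_le_mul hkle h1 (by linarith [Real.log_two_gt_d9, Real.log_nonneg hk1.le]) (by linarith)
    linarith
  · have h1 : Real.exp (1 / 80 * L / l) ≤ 2 ^ k := by
      rw [show 1 / 80 * L / l = X / 80 by rw [hX]; ring,
        ← Real.exp_log (by positivity : (0 : ℝ) < 2 ^ k), Real.log_pow, Real.exp_le_exp]
      nlinarith [Real.log_two_gt_d9]
    gcongr

end TorusQL

theorem mainTheorem5 :
    ∃ C : ℝ, 0 < C ∧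
      ∀ r₀ : ℝ, 0 < r₀ → r₀ < Real.exp (-1) →
        ∃ A : ℝ, 0 < A ∧
          ∀ r : ℝ, 0 < r → r < 1 → (r ≤ r₀ ∨ Real.exp (-1) < r) →
            TorusQL.minMass 3 r ≤
              ENNReal.ofReal
                (A * Real.exp (-Real.exp
                  (C * Real.log (1 / r) / Real.log (Real.log (1 / r))))) := by
  refine ⟨1 / 80, by norm_num, fun r₀ hr₀ hr₀e => ?_⟩
  have hL1 : 1 < Real.log (1 / r₀) := by
    have := (Real.log_lt_iff_lt_exp hr₀).2 hr₀e
    rw [one_div, Real.log_inv]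
    linarith
  have hl1 : 0 < Real.log (Real.log (1 / r₀)) := Real.log_pos hL1
  -- `B` bounds the inner exponent in both ranges of `r` where `log (1/r) < 6400`:
  -- for `r > 1/e` that exponent is negative
  set B : ℝ := 80 / Real.log (Real.log (1 / r₀)) with hB
  have hB0 : 0 < B := by positivity
  refine ⟨4 * Real.exp (Real.exp B), by positivity, fun r hr hr1 hcase => ?_⟩
  rcases le_or_gt 6400 (Real.log (1 / r)) with hL | hL
  · refine (TorusQL.minMass_three_le_of_large hr hL).trans (ENNReal.ofReal_le_ofReal ?_)
    gcongr
    have := Real.one_le_exp (Real.exp_pos B).le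
    linarith
  · refine (TorusQL.minMass_le_one 3 (by norm_num) r).trans ?_
    rw [← ENNReal.ofReal_one]
    refine ENNReal.ofReal_le_ofReal ?_
    have hL0 : 0 < Real.log (1 / r) := Real.log_pos (by rwa [one_div, one_lt_inv₀ hr])
    have hT : 1 / 80 * Real.log (1 / r) / Real.log (Real.log (1 / r)) ≤ B := by
      rcases hcase with h | h
      · have h1 : Real.log (1 / r₀) ≤ Real.log (1 / r) :=
          Real.log_le_log (by positivity) (one_div_le_one_div_of_le hr h)
        have h2 := Real.log_le_log (by linarith) h1
        rw [hB]
        gcongr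
        linarith
      · have h1 : Real.log (1 / r) < 1 := by
          have := (Real.lt_log_iff_exp_lt hr).2 h
          rw [one_div, Real.log_inv]
          linarith
        exact (div_nonpos_of_nonneg_of_nonpos (by positivity)
          (Real.log_nonpos hL0.le h1.le)).trans hB0.le
    rw [mul_assoc, ← Real.exp_add]
    have := Real.one_le_exp (sub_nonneg.2 (Real.exp_le_exp.2 hT))
    rw [sub_eq_add_neg] at this
    linarith
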